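/- Let $\mathbb{F}_q$ be a finite field with $q$ elements, $\mathbf{A}=\mathbb{F}_q[T]$, $\mathbf{k}=\mathbb{F}_q(T)$, and let $\mathbf{k}^{\mathrm{alg}}$ be an algebraic closure of $\mathbf{k}$. Let $\tau(x)=x^q$ and let $C:a\mapsto C_a$ be the Carlitz module, i.e. the $\mathbb{F}_q$-algebra homomorphism from $\mathbf{A}$ to the twisted polynomial ring $\mathbf{k}\langle\tau\rangle$ with $C_T=T+\tau$. Let $\wp\in\mathbf{A}$ be a monic irreducible polynomial, and let $\Lambda_\wp=\{x\in\mathbf{k}^{\mathrm{alg}} : C_\wp(x)=0\}$, an $\mathbf{A}$-module on which $a\in\mathbf{A}$ acts through $C_a$. Let $\lambda_\wp$ be a generator of the $\mathbf{A}$-module $\Lambda_\wp$, let $\mathbb{K}_\wp=\mathbf{k}(\Lambda_\wp)=\mathbf{k}(\lambda_\wp)$, and let $\mathcal{O}_\wp$ be the integral closure of $\mathbf{A}$ in $\mathbb{K}_\wp$. Let $\mathfrak{g}\in\mathbf{A}$ be a primitive root modulo $\wp$, i.e. its class generates the group $(\mathbf{A}/\wp\mathbf{A})^\times$. Let $\mathcal{U}_\star(\mathcal{O}_\wp)$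 be the group of units $\epsilon$ of $\mathcal{O}_\wp$ with $\mathrm{Norm}_{\mathbb{K}_\wp/\mathbf{k}}(\epsilon)=1$, and let $\mathcal{G}_\wp$ be the set of all elements $$\frac{\mathcal{Q}(\lambda_\wp)}{\mathcal{Q}(C_{\mathfrak{g}}(\lambda_\wp))},$$ where $\mathcal{Q}(x)\in\mathbf{A}[x]$ is such that $\mathcal{Q}(\lambda_\wp)$ is a unit of $\mathcal{O}_\wp$. Then: (i) $\mathcal{G}_\wp$ is a subgroup of $\mathcal{U}_\star(\mathcal{O}_\wp)$, and $[\mathcal{U}_\star(\mathcal{O}_\wp):\mathcal{G}_\wp]=q^{\deg\wp}-1$. (ii) The quotient group $\mathcal{U}_\star(\mathcal{O}_\wp)/\mathcal{G}_\wp$ is cyclic of order $q^{\deg\wp}-1$. Moreover $\lambda_\wp/C_{\mathfrak{g}}(\lambda_\wp)$ belongs to $\mathcal{U}_\star(\mathcal{O}_\wp)$, and its class generates this quotient. -/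

import Mathlib

open scoped Polynomial

noncomputable section

namespace CarlitzCyclotomic

/-- The fixed algebraic closure of the rational function field `k = F(T)`. -/
abbrev KAlg (F : Type*) [Field F] : Type _ := AlgebraicClosure (RatFunc F)

/-- The `q`-power map `τ : x ↦ x ^ q` of `k^alg`, as an `F`-linear map, where `q = #F`. -/
def tau (F : Type*) [Field F] [Fintype F] : Module.End F (KAlg F) :=
  (FiniteField.frobeniusAlgHom F (KAlg F)).toLinearMap

/-- The Carlitz module `a ↦ C_a`: the `F`-algebra homomorphism on `A = F[T]` with `C_T = T + τ`.
A twisted polynomial `∑ aᵢ τ ^ i` over `k` is identified with the operator `x ↦ ∑ aᵢ x ^ (q ^ i)`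
that it induces on `k^alg` (composition of operators being the product of twisted polynomials),
so that `carlitz F a x` is the value `C_a(x)`. -/
def carlitz (F : Type*) [Field F] [Fintype F] : F[X] →ₐ[F] Module.End F (KAlg F) :=
  Polynomial.aeval
    (LinearMap.mulLeft F (algebraMap F[X] (KAlg F) Polynomial.X) + tau F)

/-- `C_T(x) = T x + x ^ q`. -/
theorem carlitz_X (F : Type*) [Field F] [Fintype F] (x : KAlg F) :
    carlitz F Polynomial.X x
      = algebraMap F[X] (KAlg F) Polynomial.X * x + x ^ Fintype.card F := by
  simp [carlitz, tau]

/-- `C_a(x) = a x` for a constant `a ∈ F`. -/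
theorem carlitz_C (F : Type*) [Field F] [Fintype F] (a : F) (x : KAlg F) :
    carlitz F (Polynomial.C a) x = algebraMap F[X] (KAlg F) (Polynomial.C a) * x := by
  rw [carlitz, Polynomial.aeval_C, Module.algebraMap_end_apply, Algebra.smul_def]
  congr 1

/-- `Λ_m = {x ∈ k^alg | C_m(x) = 0}`. -/
def torsion {F : Type*} [Field F] [Fintype F] (m : F[X]) : Set (KAlg F) :=
  {x | carlitz F m x = 0}

/-- `x` is a primitive `m`-th root of `C`: a root of `C_m` that generates `Λ_m` as an `A`-module,
where `a ∈ A` acts through `C_a`. -/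
def IsPrimitiveTorsion {F : Type*} [Field F] [Fintype F] (m : F[X]) (x : KAlg F) : Prop :=
  x ∈ torsion m ∧ ∀ y ∈ torsion m, ∃ a : F[X], carlitz F a x = y

/-- The cyclotomic function field `K_m = k(Λ_m)`. -/
def cyclotomicField {F : Type*} [Field F] [Fintype F] (m : F[X]) :
    IntermediateField (RatFunc F) (KAlg F) :=
  IntermediateField.adjoin (RatFunc F) (torsion m)

/-- The ring of integers `O_m` of `K_m`: the integral closure of `A = F[T]` in `K_m`. -/
abbrev ringOfIntegers {F : Type*} [Field F] [Fintype F] (m : F[X]) :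
    Subalgebra F[X] (cyclotomicField m) :=
  integralClosure F[X] (cyclotomicField m)

/-- `U_*(O_m)`: the group of units of `O_m` whose norm from `K_m` to `k` is `1`. -/
def normOneUnits {F : Type*} [Field F] [Fintype F] (m : F[X]) :
    Subgroup (ringOfIntegers m)ˣ :=
  ((Algebra.norm (RatFunc F) : cyclotomicField m →* RatFunc F).comp
    ((ringOfIntegers m).val : ringOfIntegers m →* cyclotomicField m)).comp
      (Units.coeHom (ringOfIntegers m)) |>.ker

theorem mem_normOneUnits {F : Type*} [Field F] [Fintype F] {m : F[X]}
    (u : (ringOfIntegers m)ˣ) :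
    u ∈ normOneUnits m ↔
      Algebra.norm (RatFunc F) ((u : ringOfIntegers m) : cyclotomicField m) = 1 :=
  Iff.rfl

/-- A unit of `O_m`, viewed as an element of `k^alg`. -/
def unitVal {F : Type*} [Field F] [Fintype F] {m : F[X]} (u : (ringOfIntegers m)ˣ) : KAlg F :=
  (((u : ringOfIntegers m) : cyclotomicField m) : KAlg F)

/-- `g` is a primitive root modulo `m`: its class generates the group `(A / m A)ˣ`. -/
def IsPrimitiveRootMod {F : Type*} [Field F] (m g : F[X]) : Prop :=
  ∃ u : (F[X] ⧸ Ideal.span {m})ˣ,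
    (u : F[X] ⧸ Ideal.span {m}) = Ideal.Quotient.mk (Ideal.span {m}) g ∧
      Subgroup.zpowers u = ⊤

/-- The set `G_m` of all `Q(x) / Q(C_g(x))`, where `Q` runs through the polynomials over `A`
such that `Q(x)` is a unit of `O_m`. -/
def quotientSet {F : Type*} [Field F] [Fintype F] (m g : F[X]) (x : KAlg F) : Set (KAlg F) :=
  {y | ∃ Q : F[X][X], (∃ δ : (ringOfIntegers m)ˣ, unitVal δ = Polynomial.aeval x Q) ∧
    y = Polynomial.aeval x Q / Polynomial.aeval (carlitz F g x) Q}

end CarlitzCyclotomic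

end

set_option linter.unusedSectionVars false

/-- In an invariant extension, divisibility between elements of the base descends. -/
theorem Algebra.IsInvariant.dvd_of_algebraMap_dvd {A B G : Type*} [CommRing A] [CommRing B]
    [IsDomain B] [Algebra A B] [FaithfulSMul A B] [Group G] [MulSemiringAction G B]
    [SMulCommClass G A B] [Algebra.IsInvariant A B G] {a b : A}
    (h : algebraMap A B a ∣ algebraMap A B b) : a ∣ b := by
  obtain ⟨w, hw⟩ := h
  by_cases ha : a = 0
  · subst ha
    rw [map_zero, zero_mul, map_eq_zero_iff _ (FaithfulSMul.algebraMap_injective A B)] at hw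
    rw [hw]
  have ha' : algebraMap A B a ≠ 0 :=
    (map_ne_zero_iff _ (FaithfulSMul.algebraMap_injective A B)).2 ha
  obtain ⟨c, rfl⟩ := Algebra.IsInvariant.isInvariant (A := A) (G := G) w fun g => by
    apply mul_left_cancel₀ ha'
    have := congrArg (g • ·) hw
    simp only [smul_mul', smul_algebraMap] at this
    rw [← this, hw]
  rw [← map_mul] at hw
  exact ⟨c, FaithfulSMul.algebraMap_injective A B hw⟩

theorem Algebra.IsInvariant.associated_of_algebraMap {A B G : Type*} [CommRing A] [IsDomain A]
    [CommRing B]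
    [IsDomain B] [Algebra A B] [FaithfulSMul A B] [Group G] [MulSemiringAction G B]
    [SMulCommClass G A B] [Algebra.IsInvariant A B G] {a b : A}
    (h : Associated (algebraMap A B a) (algebraMap A B b)) : Associated a b :=
  associated_of_dvd_dvd (dvd_of_algebraMap_dvd (G := G) h.dvd)
    (dvd_of_algebraMap_dvd (G := G) h.symm.dvd)

theorem Prime.dvd_of_associated_pow {A : Type*} [CommRing A] [IsDomain A] {p c : A}
    (hp : Prime p) {n j : ℕ} (hn : n ≠ 0) (h : Associated (c ^ n) (p ^ j)) : n ∣ j := by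
  obtain ⟨i, -, hi⟩ := (dvd_prime_pow hp j).1 ((dvd_pow_self c hn).trans h.dvd)
  have h2 : Associated (p ^ (i * n)) (p ^ j) := by
    rw [pow_mul]
    exact (hi.symm.pow_pow).trans h
  refine ⟨i, ?_⟩
  have h3 := (pow_dvd_pow_iff hp.ne_zero hp.not_isUnit).1 h2.dvd
  have h4 := (pow_dvd_pow_iff hp.ne_zero hp.not_isUnit).1 h2.symm.dvd
  rw [mul_comm]; omega

/-- Hilbert's theorem 90 for a cyclic group of automorphisms of an integral domain. -/
theorem exists_ne_zero_mul_smul_eq {B G : Type*} [CommRing B] [IsDomain B] [Group G] [Fintype G]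
    [MulSemiringAction G B] [FaithfulSMul G B] {σ : G} (hσ : ∀ τ, τ ∈ Subgroup.zpowers σ) {η : B}
    (hη : ∏ τ : G, τ • η = 1) : ∃ ε : B, ε ≠ 0 ∧ η * σ • ε = ε := by
  classical
  let c : ℕ → B := fun i => ∏ j ∈ Finset.range i, σ ^ j • η
  have hc : ∀ i, c (i + 1) = η * σ • c i := fun i => by
    simp only [c]
    rw [Finset.prod_range_succ', pow_zero, one_smul, mul_comm, Finset.smul_prod']
    simp only [pow_succ', mul_smul]
  have horder : orderOf σ = Nat.card G := orderOf_eq_card_of_forall_mem_zpowers hσ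
  have hcN : c (Nat.card G) = 1 := by
    rw [← hη, ← IsCyclic.image_range_card hσ, Finset.prod_image]
    intro i hi j hj hij
    refine pow_injOn_Iio_orderOf ?_ ?_ hij
    · rw [horder]; simpa using hi
    · rw [horder]; simpa using hj
  obtain ⟨z, hz⟩ : ∃ z : B, ∑ i ∈ Finset.range (Nat.card G), c i * σ ^ i • z ≠ 0 := by
    by_contra! hall
    have hli : LinearIndependent B fun i : Fin (Nat.card G) =>
        ((MulSemiringAction.toRingHom G B (σ ^ (i : ℕ)) : B →* B) : B → B) := by
      refine (linearIndependent_monoidHom B B).comp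
        (fun i : Fin (Nat.card G) => (MulSemiringAction.toRingHom G B (σ ^ (i : ℕ)) : B →* B)) ?_
      intro i j hij
      have h1 : σ ^ (i : ℕ) = σ ^ (j : ℕ) := by
        apply FaithfulSMul.eq_of_smul_eq_smul (α := B)
        exact fun b => DFunLike.congr_fun hij b
      refine Fin.ext (pow_injOn_Iio_orderOf ?_ ?_ h1)
      · rw [horder]; exact i.2
      · rw [horder]; exact j.2
    have h0 := Fintype.linearIndependent_iff.1 hli (fun i => c i) (by
      ext z
      have := hall z
      rw [Finset.sum_range] at this
      simpa using this) ⟨0, Nat.card_pos⟩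
    simp [c] at h0
  refine ⟨_, hz, ?_⟩
  rw [Finset.smul_sum, Finset.mul_sum]
  have h1 : ∀ i ∈ Finset.range (Nat.card G), η * σ • (c i * σ ^ i • z)
      = c (i + 1) * σ ^ (i + 1) • z := fun i _ => by
    rw [hc, smul_mul', pow_succ', mul_smul, mul_assoc]
  rw [Finset.sum_congr rfl h1]
  have h2 := Finset.sum_range_succ (fun i => c i * σ ^ i • z) (Nat.card G)
  rw [Finset.sum_range_succ', hcN, pow_card_eq_one'] at h2
  simpa [c] using h2

section Interpolation

variable {A B G : Type*} [CommRing A] [CommRing B] [Algebra A B] [Group G] [Fintype G]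
  [MulSemiringAction G B]

/-- A Galois-equivariant form of Lagrange interpolation at the conjugates of `lam`. -/
theorem exists_mul_aeval_derivative_eq [SMulCommClass G A B] [Algebra.IsInvariant A B G]
    [IsDomain B] [FaithfulSMul A B]
    {f : A[X]} {lam : B}
    (hf : f.map (algebraMap A B) = ∏ σ : G, (Polynomial.X - Polynomial.C (σ • lam)))
    {x β : B} (hx : β ∣ x) (hβ : ∀ σ : G, β ∣ σ • β) {a : A}
    (ha : ∀ b : A, β ∣ algebraMap A B b → a ∣ b) :
    ∃ H : A[X], x * Polynomial.aeval lam (Polynomial.derivative f)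
      = algebraMap A B a * Polynomial.aeval lam H := by
  classical
  let R : G → B[X] := fun σ =>
    ∏ τ ∈ Finset.univ.erase σ, (Polynomial.X - Polynomial.C (τ • lam))
  let S : B[X] := ∑ σ : G, Polynomial.C (σ • x) * R σ
  have hR1 : ∀ σ : G, σ ≠ 1 → (R σ).eval lam = 0 := fun σ hσ => by
    rw [Polynomial.eval_prod]
    exact Finset.prod_eq_zero (Finset.mem_erase.2 ⟨hσ.symm, Finset.mem_univ _⟩) (by simp)
  have hder : Polynomial.aeval lam (Polynomial.derivative f) = (R 1).eval lam := by
    rw [← Polynomial.eval_map_algebraMap, ← Polynomial.derivative_map, hf,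
      Polynomial.derivative_prod_finset, Polynomial.eval_finsetSum,
      Finset.sum_eq_single (1 : G)]
    · simp [R]
    · intro σ _ hσ
      have := hR1 σ hσ
      simp only [R] at this
      simp [this]
    · simp
  have hS : S.eval lam = x * Polynomial.aeval lam (Polynomial.derivative f) := by
    rw [hder, Polynomial.eval_finsetSum, Finset.sum_eq_single (1 : G)]
    · simp
    · intro σ _ hσ
      simp [hR1 σ hσ]
    · simp
  have hRsmul : ∀ ρ σ : G, ρ • R σ = R (ρ * σ) := fun ρ σ => by
    simp only [R]
    rw [Finset.smul_prod']
    refine Finset.prod_bij' (fun τ _ => ρ * τ) (fun τ _ => ρ⁻¹ * τ) ?_ ?_ ?_ ?_ ?_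
    · intro τ hτ; simpa using hτ
    · intro τ hτ
      simp only [Finset.mem_erase, Finset.mem_univ, and_true] at hτ ⊢
      rintro rfl; simp at hτ
    · simp
    · simp
    · intro τ _
      simp [smul_sub, mul_smul, Polynomial.smul_C]
  have hSsmul : ∀ ρ : G, ρ • S = S := fun ρ => by
    simp only [S]
    rw [Finset.smul_sum]
    refine Fintype.sum_equiv (Equiv.mulLeft ρ) _ _ fun σ => ?_
    simp [smul_mul', hRsmul, mul_smul, Polynomial.smul_C]
  have hcoeff : ∀ i, ∃ c : A, S.coeff i = algebraMap A B (a * c) := fun i => by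
    obtain ⟨b, hb⟩ := Algebra.IsInvariant.isInvariant (A := A) (G := G) (S.coeff i) fun g => by
      conv_rhs => rw [← hSsmul g]
      rfl
    have : β ∣ algebraMap A B b := by
      rw [hb]
      simp only [S, Polynomial.finsetSum_coeff, Polynomial.coeff_C_mul]
      refine Finset.dvd_sum fun σ _ => Dvd.dvd.mul_right ?_ _
      obtain ⟨y, rfl⟩ := hx
      rw [smul_mul']
      exact (hβ σ).mul_right _
    obtain ⟨c, rfl⟩ := ha b this
    exact ⟨c, hb.symm⟩
  choose c hc using hcoeff
  refine ⟨∑ i ∈ Finset.range (S.natDegree + 1), Polynomial.monomial i (c i), ?_⟩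
  rw [← hS, Polynomial.eval_eq_sum_range, map_sum, Finset.mul_sum]
  refine Finset.sum_congr rfl fun i _ => ?_
  rw [hc, map_mul, Polynomial.aeval_monomial, mul_assoc]

end Interpolation

/-- A totally ramified situation: `lam` is an element of the extension `B` of `A`, with group of
automorphisms `G`, that is a root of a polynomial `f` whose constant coefficient is the prime `p`,
whose roots are the conjugates of `lam`, and such that the different `f'(lam)` is `p / lam`;
moreover `p` is associated to a power of `lam`. -/
structure IsTotallyRamifiedGenerator (A B G : Type*) [CommRing A] [CommRing B] [Algebra A B]
    [Group G] [Fintype G] [MulSemiringAction G B] (p : A) (n : ℕ) (lam : B) (f : A[X]) :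
    Prop where
  prime : Prime p
  ne_zero : n ≠ 0
  map_eq : f.map (algebraMap A B) = ∏ σ : G, (Polynomial.X - Polynomial.C (σ • lam))
  coeff_zero : f.coeff 0 = p
  aeval_derivative_mul :
    Polynomial.aeval lam (Polynomial.derivative f) * lam = algebraMap A B p
  associated : Associated (lam ^ n) (algebraMap A B p)

namespace IsTotallyRamifiedGenerator

variable {A B G : Type*} [CommRing A] [CommRing B] [Algebra A B] [Group G] [Fintype G]
  [MulSemiringAction G B] [SMulCommClass G A B] [Algebra.IsInvariant A B G]
    [IsDomain B] [FaithfulSMul A B] {p : A} {n : ℕ} {lam : B} {f : A[X]}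
  (h : IsTotallyRamifiedGenerator A B G p n lam f)

include h

theorem algebraMap_ne_zero : algebraMap A B p ≠ 0 :=
  (map_ne_zero_iff _ (FaithfulSMul.algebraMap_injective A B)).2 h.prime.ne_zero

theorem lam_ne_zero : lam ≠ 0 := by
  rintro rfl
  exact h.algebraMap_ne_zero (by rw [← h.aeval_derivative_mul, mul_zero])

theorem dvd_of_lam_dvd {b : A} (hb : lam ∣ algebraMap A B b) : p ∣ b := by
  apply h.prime.dvd_of_dvd_pow (n := n)
  apply Algebra.IsInvariant.dvd_of_algebraMap_dvd (B := B) (G := G)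
  rw [map_pow]
  exact h.associated.symm.dvd.trans (pow_dvd_pow_of_dvd hb n)

theorem aeval_eq_zero : Polynomial.aeval lam f = 0 := by
  rw [← Polynomial.eval_map_algebraMap, h.map_eq, Polynomial.eval_prod]
  exact Finset.prod_eq_zero (Finset.mem_univ 1) (by simp)

theorem exists_algebraMap_eq_mul_aeval : ∃ Q : A[X],
    algebraMap A B p = lam * Polynomial.aeval lam Q := by
  have h1 := h.aeval_eq_zero
  rw [← Polynomial.X_mul_divX_add f, map_add, map_mul, Polynomial.aeval_X, Polynomial.aeval_C,
    h.coeff_zero] at h1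
  refine ⟨-f.divX, ?_⟩
  rw [map_neg]
  linear_combination h1

theorem exists_aeval_of_mul {z : B} (hz : ∃ Q : A[X], lam * z = Polynomial.aeval lam Q) :
    ∃ Q : A[X], z = Polynomial.aeval lam Q := by
  obtain ⟨Q, hQ⟩ := hz
  rw [← Polynomial.X_mul_divX_add Q, map_add, map_mul, Polynomial.aeval_X,
    Polynomial.aeval_C] at hQ
  obtain ⟨c, hc⟩ := h.dvd_of_lam_dvd (b := Q.coeff 0)
    ⟨z - Polynomial.aeval lam Q.divX, by linear_combination -hQ⟩
  obtain ⟨E, hE⟩ := h.exists_algebraMap_eq_mul_aeval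
  refine ⟨Q.divX + E * Polynomial.C c, mul_left_cancel₀ h.lam_ne_zero ?_⟩
  rw [hQ, hc, map_mul, hE, map_add, map_mul, Polynomial.aeval_C]
  ring

/-- `B` is generated by `lam` over `A`. -/
theorem exists_aeval (z : B) : ∃ Q : A[X], z = Polynomial.aeval lam Q := by
  have h1 : ∀ y : B, ∃ Q : A[X], algebraMap A B p * y = Polynomial.aeval lam Q := fun y => by
    obtain ⟨H, hH⟩ := exists_mul_aeval_derivative_eq h.map_eq (one_dvd y)
      (fun σ => one_dvd _) (a := 1) (fun b _ => one_dvd b)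
    refine ⟨H * Polynomial.X, ?_⟩
    rw [← h.aeval_derivative_mul, map_mul, Polynomial.aeval_X]
    rw [map_one, one_mul] at hH
    rw [← hH]; ring
  have h2 : ∀ i : ℕ, ∀ y : B, (∃ Q : A[X], lam ^ i * y = Polynomial.aeval lam Q) →
      ∃ Q : A[X], y = Polynomial.aeval lam Q := by
    intro i
    induction i with
    | zero => intro y hy; simpa using hy
    | succ i ih =>
      rintro y ⟨Q, hQ⟩
      refine ih y (h.exists_aeval_of_mul ⟨Q, ?_⟩)
      rw [← hQ]; ring
  obtain ⟨u, hu⟩ := h.associated.symm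
  refine h2 n z ?_
  obtain ⟨Q, hQ⟩ := h1 (u * z)
  exact ⟨Q, by rw [← hQ, ← hu]; ring⟩

theorem prime_lam : Prime lam := by
  refine ⟨h.lam_ne_zero, fun hu => ?_, fun x y hxy => ?_⟩
  · exact h.prime.not_dvd_one (h.dvd_of_lam_dvd hu.dvd)
  · obtain ⟨Q, rfl⟩ := h.exists_aeval x
    obtain ⟨R, rfl⟩ := h.exists_aeval y
    have h1 : ∀ Q : A[X], lam ∣ Polynomial.aeval lam Q ↔ p ∣ Q.coeff 0 := fun Q => by
      have h2 : lam ∣ Polynomial.aeval lam Q ↔ lam ∣ algebraMap A B (Q.coeff 0) := by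
        conv_lhs => rw [← Polynomial.X_mul_divX_add Q, map_add, map_mul, Polynomial.aeval_X,
          Polynomial.aeval_C]
        exact dvd_add_right (dvd_mul_right _ _)
      rw [h2]
      refine ⟨h.dvd_of_lam_dvd, fun h3 => ?_⟩
      exact ((dvd_pow_self lam h.ne_zero).trans h.associated.dvd).trans
        (map_dvd (algebraMap A B) h3)
    rw [← map_mul, h1, Polynomial.mul_coeff_zero] at hxy
    rw [h1, h1]
    exact h.prime.dvd_or_dvd hxy

/-- An element that generates an invariant principal ideal is, up to elements of the base and units,
a power of `lam`. -/
theorem exists_eq_mul_pow_mul_unit [IsPrincipalIdealRing A] [Algebra.IsIntegral A B] {β : B}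
    (hβ0 : β ≠ 0) (hβ : ∀ σ : G, β ∣ σ • β) :
    ∃ (a : A) (i : ℕ) (δ : Bˣ), algebraMap A B p * β = algebraMap A B a * lam ^ i * δ := by
  obtain ⟨a, ha⟩ := IsPrincipalIdealRing.principal
    ((Ideal.span {β}).comap (algebraMap A B))
  have hmem : ∀ b : A, a ∣ b ↔ β ∣ algebraMap A B b := fun b => by
    rw [← Ideal.mem_span_singleton, ← Ideal.mem_span_singleton (y := β), ← Ideal.mem_comap, ha]
  obtain ⟨η, hη⟩ := (hmem a).1 dvd_rfl
  obtain ⟨H, hH⟩ := exists_mul_aeval_derivative_eq h.map_eq (dvd_refl β) hβ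
    (fun b => (hmem b).2)
  have h1 : algebraMap A B p = η * (Polynomial.aeval lam H * lam) := by
    rw [← h.aeval_derivative_mul]
    apply mul_left_cancel₀ hβ0
    rw [← mul_assoc, hH, hη]; ring
  obtain ⟨i, -, hi⟩ := (dvd_prime_pow h.prime_lam n).1
    ((Dvd.intro_left η h1.symm).trans h.associated.symm.dvd)
  obtain ⟨δ, hδ⟩ := hi.symm
  refine ⟨a, i, δ, ?_⟩
  rw [mul_assoc, hδ, ← h.aeval_derivative_mul]
  linear_combination lam * hH

theorem dvd_of_pow_mul_smul_eq [IsDomain A] {σ : G}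
    (hσ : ∀ τ, τ ∈ Subgroup.zpowers σ) {j : ℕ} {δ : Bˣ}
    (hj : lam ^ j * σ • (δ : B) = (σ • lam) ^ j * δ) : n ∣ j := by
  have hfix : σ • (lam ^ j * ((δ⁻¹ : Bˣ) : B)) = lam ^ j * ((δ⁻¹ : Bˣ) : B) := by
    have h1 : σ • (δ : B) * σ • ((δ⁻¹ : Bˣ) : B) = 1 := by
      rw [← smul_mul', Units.mul_inv, smul_one]
    have h2 : (δ : B) * ((δ⁻¹ : Bˣ) : B) = 1 := δ.mul_inv
    rw [smul_mul', smul_pow']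
    linear_combination (-(((δ⁻¹ : Bˣ) : B) * σ • ((δ⁻¹ : Bˣ) : B))) * hj
      - (σ • lam) ^ j * (σ • ((δ⁻¹ : Bˣ) : B)) * h2 + lam ^ j * ((δ⁻¹ : Bˣ) : B) * h1
  obtain ⟨c, hc⟩ := Algebra.IsInvariant.isInvariant (A := A) (G := G)
    (lam ^ j * ((δ⁻¹ : Bˣ) : B)) fun τ => by
      have : σ ∈ MulAction.stabilizer G (lam ^ j * ((δ⁻¹ : Bˣ) : B)) := hfix
      exact (Subgroup.zpowers_le.2 this) (hσ τ)
  refine h.prime.dvd_of_associated_pow (c := c) h.ne_zero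
    (Algebra.IsInvariant.associated_of_algebraMap (B := B) (G := G) ?_)
  rw [map_pow, hc, map_pow, mul_pow, ← pow_mul, mul_comm j n, pow_mul]
  refine Associated.trans ?_ h.associated.pow_pow
  rw [← Units.val_pow_eq_pow_val]
  exact associated_mul_unit_left _ _ (Units.isUnit _)

theorem exists_unit_pow_mul_smul_eq (σ : G) : ∃ δ : Bˣ,
    lam ^ n * σ • (δ : B) = (σ • lam) ^ n * δ := by
  obtain ⟨u, hu⟩ := h.associated
  refine ⟨u⁻¹, ?_⟩
  have h0 := congrArg (σ • ·) hu
  simp only [smul_mul', smul_pow', smul_algebraMap] at h0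
  have h1 : σ • (u : B) * σ • ((u⁻¹ : Bˣ) : B) = 1 := by
    rw [← smul_mul', Units.mul_inv, smul_one]
  have h2 : (u : B) * ((u⁻¹ : Bˣ) : B) = 1 := u.mul_inv
  rw [← hu] at h0
  linear_combination (-(((u⁻¹ : Bˣ) : B) * σ • ((u⁻¹ : Bˣ) : B))) * h0
    - (lam ^ n) * (σ • ((u⁻¹ : Bˣ) : B)) * h2 + (σ • lam) ^ n * ((u⁻¹ : Bˣ) : B) * h1

theorem exists_pow_mul_unit_eq [IsDomain A] [IsPrincipalIdealRing A] [Algebra.IsIntegral A B]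
    {σ : G} (hσ : ∀ τ, τ ∈ Subgroup.zpowers σ) {η : Bˣ} {ε : B} (hε0 : ε ≠ 0)
    (hε : (η : B) * σ • ε = ε) :
    ∃ (i : ℕ) (δ : Bˣ), (η : B) * ((σ • lam) ^ i * σ • (δ : B)) = lam ^ i * δ := by
  have hdvd : ∀ τ : G, ε ∣ τ • ε := fun τ => by
    obtain ⟨m, hm⟩ := mem_powers_iff_mem_zpowers.2 (hσ τ)
    simp only at hm
    rw [← hm]
    clear hm
    induction m with
    | zero => simp
    | succ m ih =>
      rw [pow_succ, mul_smul]
      refine ih.trans ?_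
      have : ε ∣ σ • ε := ⟨((η⁻¹ : Bˣ) : B), by
        linear_combination ((η⁻¹ : Bˣ) : B) * hε - (σ • ε) * η.mul_inv⟩
      obtain ⟨w, hw⟩ := this
      rw [hw, smul_mul']
      exact dvd_mul_right _ _
  obtain ⟨a, i, δ, h1⟩ := h.exists_eq_mul_pow_mul_unit hε0 hdvd
  have ha : algebraMap A B a ≠ 0 := by
    intro h0
    rw [h0, zero_mul, zero_mul] at h1
    exact mul_ne_zero h.algebraMap_ne_zero hε0 h1
  refine ⟨i, δ, mul_left_cancel₀ ha ?_⟩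
  have h2 := congrArg (σ • ·) h1
  simp only [smul_mul', smul_pow', smul_algebraMap] at h2
  linear_combination (-(η : B)) * h2 + h1 + algebraMap A B p * hε

end IsTotallyRamifiedGenerator

namespace CarlitzCyclotomic

section CarlitzAction

variable (F : Type*) [Field F] [Fintype F]

/-- The Carlitz module structure on a commutative `F[T]`-algebra. -/
noncomputable def carlitzAction (R : Type*) [CommRing R] [Algebra F R] [Algebra F[X] R] :
    F[X] →ₐ[F] Module.End F R :=
  Polynomial.aeval
    (LinearMap.mulLeft F (algebraMap F[X] R Polynomial.X)
      + (FiniteField.frobeniusAlgHom F R).toLinearMap)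

variable {F} {R S : Type*} [CommRing R] [Algebra F R] [Algebra F[X] R]
  [CommRing S] [Algebra F S] [Algebra F[X] S]

theorem carlitzAction_X (x : R) :
    carlitzAction F R Polynomial.X x
      = algebraMap F[X] R Polynomial.X * x + x ^ Fintype.card F := by
  simp [carlitzAction]

theorem carlitzAction_C (c : F) (x : R) : carlitzAction F R (Polynomial.C c) x = c • x := by
  rw [carlitzAction, Polynomial.aeval_C, Module.algebraMap_end_apply]

theorem carlitzAction_mul (a b : F[X]) (x : R) :
    carlitzAction F R (a * b) x = carlitzAction F R a (carlitzAction F R b x) := by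
  rw [map_mul, Module.End.mul_apply]

theorem map_carlitzAction [IsScalarTower F F[X] R] [IsScalarTower F F[X] S]
    (φ : R →ₐ[F[X]] S) (a : F[X]) (x : R) :
    φ (carlitzAction F R a x) = carlitzAction F S a (φ x) := by
  have hφ : ∀ (c : F) (y : R), φ (c • y) = c • φ y := fun c y => by
    rw [← algebraMap_smul F[X] c y, map_smul, algebraMap_smul]
  induction a using Polynomial.induction_on' generalizing x with
  | add p q hp hq => rw [map_add, map_add, LinearMap.add_apply, LinearMap.add_apply, map_add,
      hp, hq]
  | monomial n c =>
    induction n generalizing x with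
    | zero => rw [Polynomial.monomial_zero_left, carlitzAction_C, carlitzAction_C, hφ]
    | succ n ih =>
      rw [← Polynomial.monomial_mul_X, carlitzAction_mul, carlitzAction_mul, ih,
        carlitzAction_X, carlitzAction_X, map_add, map_mul, map_pow, AlgHom.commutes]

variable (F) in
/-- The polynomial `C_a(x)` with coefficients in `F[T]`. -/
noncomputable def carlitzPoly (a : F[X]) : F[X][X] := carlitzAction F F[X][X] a Polynomial.X

theorem aeval_carlitzPoly [IsScalarTower F F[X] R] (a : F[X]) (x : R) :
    Polynomial.aeval x (carlitzPoly F a) = carlitzAction F R a x := by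
  rw [carlitzPoly, map_carlitzAction, Polynomial.aeval_X]

theorem aeval_carlitzPoly_eq_carlitz (a : F[X]) (x : KAlg F) :
    Polynomial.aeval x (carlitzPoly F a) = carlitz F a x :=
  aeval_carlitzPoly a x

theorem X_dvd_carlitzPoly (a : F[X]) : Polynomial.X ∣ carlitzPoly F a := by
  rw [Polynomial.X_dvd_iff, Polynomial.coeff_zero_eq_aeval_zero, aeval_carlitzPoly, map_zero]

theorem derivative_carlitzAction (a : F[X]) (f : F[X][X]) :
    Polynomial.derivative (carlitzAction F F[X][X] a f)
      = Polynomial.C a * Polynomial.derivative f := by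
  have hq : ((Fintype.card F : ℕ) : F[X][X]) = 0 := by
    rw [← map_natCast (algebraMap F F[X][X]), Nat.cast_card_eq_zero, map_zero]
  induction a using Polynomial.induction_on' generalizing f with
  | add p q hp hq => rw [map_add, LinearMap.add_apply, map_add, hp, hq, map_add, add_mul]
  | monomial n c =>
    induction n generalizing f with
    | zero =>
      rw [Polynomial.monomial_zero_left, carlitzAction_C, Polynomial.derivative_smul,
        Algebra.smul_def]
      rfl
    | succ n ih =>
      rw [← Polynomial.monomial_mul_X, carlitzAction_mul, ih, carlitzAction_X, map_add,
        Polynomial.derivative_pow, Polynomial.C_mul]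
      simp only [Polynomial.algebraMap_eq, Polynomial.derivative_C_mul]
      rw [map_natCast, hq]
      ring

theorem derivative_carlitzPoly (a : F[X]) :
    Polynomial.derivative (carlitzPoly F a) = Polynomial.C a := by
  rw [carlitzPoly, derivative_carlitzAction, Polynomial.derivative_X, mul_one]

theorem carlitzPoly_monic_natDegree {a : F[X]} (ha : a.Monic) :
    (carlitzPoly F a).Monic ∧
      (carlitzPoly F a).natDegree = Fintype.card F ^ a.natDegree := by
  induction hd : a.natDegree generalizing a with
  | zero =>
    rw [ha.natDegree_eq_zero.1 hd]
    simp [carlitzPoly, Polynomial.monic_X]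
  | succ d ih =>
    have hdiv : a.divX.natDegree = d := by
      rw [Polynomial.natDegree_divX_eq_natDegree_tsub_one, hd]; rfl
    have hmon : a.divX.Monic := by
      rw [Polynomial.Monic, Polynomial.leadingCoeff, Polynomial.coeff_divX, hdiv, ← hd]
      exact ha
    obtain ⟨h1, h2⟩ := ih hmon hdiv
    set f := carlitzPoly F a.divX with hf
    have hq : 1 < Fintype.card F := Fintype.one_lt_card
    have heq : carlitzPoly F a = f ^ Fintype.card F
        + (Polynomial.C Polynomial.X * f
          + Polynomial.C (Polynomial.C (a.coeff 0)) * Polynomial.X) := by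
      conv_lhs => rw [← Polynomial.X_mul_divX_add a]
      rw [carlitzPoly, map_add, LinearMap.add_apply, carlitzAction_mul, carlitzAction_X,
        carlitzAction_C, ← carlitzPoly, ← hf, Algebra.smul_def, Polynomial.algebraMap_eq]
      have : algebraMap F F[X][X] (a.coeff 0) = Polynomial.C (Polynomial.C (a.coeff 0)) := rfl
      rw [this]; ring
    have hpow : (f ^ Fintype.card F).natDegree = Fintype.card F ^ (d + 1) := by
      rw [h1.natDegree_pow, h2, pow_succ, mul_comm]
    have hlow : (Polynomial.C Polynomial.X * f
        + Polynomial.C (Polynomial.C (a.coeff 0)) * Polynomial.X).natDegree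
        ≤ Fintype.card F ^ d := by
      refine (Polynomial.natDegree_add_le _ _).trans (max_le ?_ ?_)
      · exact (Polynomial.natDegree_C_mul_le _ _).trans h2.le
      · refine (Polynomial.natDegree_C_mul_le _ _).trans ?_
        rw [Polynomial.natDegree_X]
        exact Nat.one_le_pow _ _ (by omega)
    have hlt : (Polynomial.C Polynomial.X * f
        + Polynomial.C (Polynomial.C (a.coeff 0)) * Polynomial.X).degree
        < (f ^ Fintype.card F).degree := by
      apply Polynomial.degree_lt_degree
      rw [hpow]
      exact hlow.trans_lt (Nat.pow_lt_pow_right hq (Nat.lt_succ_self d))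
    rw [heq]
    refine ⟨(h1.pow _).add_of_left hlt, ?_⟩
    rw [Polynomial.natDegree_add_eq_left_of_degree_lt hlt, hpow]

/-- The polynomial `C_a(x) / x`. -/
noncomputable def carlitzPolyDivX (a : F[X]) : F[X][X] := (carlitzPoly F a).divX

theorem carlitzPoly_eq_X_mul (a : F[X]) :
    carlitzPoly F a = Polynomial.X * carlitzPolyDivX a := by
  conv_lhs => rw [← Polynomial.X_mul_divX_add (carlitzPoly F a)]
  rw [Polynomial.X_dvd_iff.1 (X_dvd_carlitzPoly a), map_zero, add_zero, carlitzPolyDivX]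

theorem aeval_carlitzPoly_eq_mul {R : Type*} [CommRing R] [Algebra F[X] R] (a : F[X]) (x : R) :
    Polynomial.aeval x (carlitzPoly F a) = x * Polynomial.aeval x (carlitzPolyDivX a) := by
  rw [carlitzPoly_eq_X_mul, map_mul, Polynomial.aeval_X]

theorem dvd_aeval_carlitzPoly {R : Type*} [CommRing R] [Algebra F[X] R] (a : F[X]) (x : R) :
    x ∣ Polynomial.aeval x (carlitzPoly F a) :=
  ⟨_, aeval_carlitzPoly_eq_mul a x⟩

theorem aeval_carlitzPoly_mul {R : Type*} [CommRing R] [Algebra F[X] R] (a b : F[X]) (x : R) :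
    Polynomial.aeval x (carlitzPoly F (a * b))
      = Polynomial.aeval (Polynomial.aeval x (carlitzPoly F b)) (carlitzPoly F a) := by
  rw [← Polynomial.aeval_comp, carlitzPoly, carlitzAction_mul, ← carlitzPoly,
    ← aeval_carlitzPoly, Polynomial.comp_eq_aeval]

theorem aeval_carlitzPoly_add {R : Type*} [CommRing R] [Algebra F[X] R] (a b : F[X]) (x : R) :
    Polynomial.aeval x (carlitzPoly F (a + b))
      = Polynomial.aeval x (carlitzPoly F a) + Polynomial.aeval x (carlitzPoly F b) := by
  rw [carlitzPoly, map_add, LinearMap.add_apply, map_add, carlitzPoly, carlitzPoly]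

theorem aeval_zero_carlitzPoly {R : Type*} [CommRing R] [Algebra F[X] R] (a : F[X]) :
    Polynomial.aeval (0 : R) (carlitzPoly F a) = 0 := by
  rw [aeval_carlitzPoly_eq_mul, zero_mul]

theorem derivative_carlitzPolyDivX (a : F[X]) :
    carlitzPolyDivX a + Polynomial.X * Polynomial.derivative (carlitzPolyDivX a)
      = Polynomial.C a := by
  rw [← derivative_carlitzPoly, carlitzPoly_eq_X_mul, Polynomial.derivative_mul,
    Polynomial.derivative_X, one_mul]

theorem coeff_zero_carlitzPolyDivX (a : F[X]) : (carlitzPolyDivX a).coeff 0 = a := by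
  simpa using congrArg (Polynomial.coeff · 0) (derivative_carlitzPolyDivX a)

theorem carlitzPolyDivX_monic {a : F[X]} (ha : a.Monic) : (carlitzPolyDivX a).Monic := by
  refine Polynomial.Monic.of_mul_monic_left Polynomial.monic_X ?_
  rw [← carlitzPoly_eq_X_mul]
  exact (carlitzPoly_monic_natDegree ha).1

theorem natDegree_carlitzPolyDivX {a : F[X]} (ha : a.Monic) :
    (carlitzPolyDivX a).natDegree = Fintype.card F ^ a.natDegree - 1 := by
  rw [carlitzPolyDivX, Polynomial.natDegree_divX_eq_natDegree_tsub_one,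
    (carlitzPoly_monic_natDegree ha).2]

/-- A division point of an integral domain is associated to its Carlitz multiples by elements prime
to its annihilator. -/
theorem associated_aeval_carlitzPoly {R : Type*} [CommRing R] [Algebra F[X] R] [IsDomain R]
    {m a : F[X]} (h : IsCoprime m a) {x : R} (hx : Polynomial.aeval x (carlitzPoly F m) = 0) :
    Associated (Polynomial.aeval x (carlitzPoly F a)) x := by
  refine associated_of_dvd_dvd ?_ (dvd_aeval_carlitzPoly a x)
  obtain ⟨u, v, huv⟩ := h
  have h1 : Polynomial.aeval (Polynomial.aeval x (carlitzPoly F a)) (carlitzPoly F v) = x := by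
    have h2 : Polynomial.aeval x (carlitzPoly F (1 : F[X])) = x := by
      simp [carlitzPoly]
    rw [← huv, aeval_carlitzPoly_add, aeval_carlitzPoly_mul, aeval_carlitzPoly_mul, hx,
      aeval_zero_carlitzPoly, zero_add] at h2
    exact h2
  conv_rhs => rw [← h1]
  exact dvd_aeval_carlitzPoly _ _

end CarlitzAction

section CyclotomicField

variable {F : Type*} [Field F] [Fintype F] {P : F[X]}


variable (F) in
theorem algebraMap_KAlg_injective : Function.Injective (algebraMap F[X] (KAlg F)) := by
  rw [IsScalarTower.algebraMap_eq F[X] (RatFunc F) (KAlg F)]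
  exact (algebraMap (RatFunc F) (KAlg F)).injective.comp
    (IsFractionRing.injective F[X] (RatFunc F))

variable (P) in
/-- The inclusion of the ring of integers in the algebraic closure. -/
noncomputable def ringOfIntegersVal : ringOfIntegers P →ₐ[F[X]] KAlg F :=
  ((cyclotomicField P).val.restrictScalars F[X]).comp (ringOfIntegers P).val

theorem ringOfIntegersVal_injective : Function.Injective (ringOfIntegersVal P) :=
  fun _ _ h => Subtype.ext (Subtype.ext h)

theorem torsion_eq_rootSet (hP : P.Monic) :
    torsion P = ((carlitzPoly F P).map (algebraMap F[X] (RatFunc F))).rootSet (KAlg F) := by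
  ext x
  rw [Polynomial.mem_rootSet_of_ne
    ((carlitzPoly_monic_natDegree hP).1.map _).ne_zero, Polynomial.aeval_map_algebraMap,
    aeval_carlitzPoly_eq_carlitz]
  rfl

theorem separable_carlitzPoly (hP : P ≠ 0) :
    ((carlitzPoly F P).map (algebraMap F[X] (RatFunc F))).Separable := by
  rw [Polynomial.Separable, Polynomial.derivative_map, derivative_carlitzPoly, Polynomial.map_C]
  have : algebraMap F[X] (RatFunc F) P ≠ 0 := by simpa using hP
  refine ⟨0, Polynomial.C (algebraMap F[X] (RatFunc F) P)⁻¹, ?_⟩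
  rw [zero_mul, zero_add, ← Polynomial.C_mul, inv_mul_cancel₀ this, Polynomial.C_1]

theorem isSplittingField_cyclotomicField (hP : P.Monic) :
    ((carlitzPoly F P).map (algebraMap F[X] (RatFunc F))).IsSplittingField (RatFunc F)
      (cyclotomicField P) := by
  rw [cyclotomicField, torsion_eq_rootSet hP]
  exact IntermediateField.adjoin_rootSet_isSplittingField (IsAlgClosed.splits _)

theorem isGalois_cyclotomicField (hP : P.Monic) : IsGalois (RatFunc F) (cyclotomicField P) :=
  haveI := isSplittingField_cyclotomicField hP
  IsGalois.of_separable_splitting_field (separable_carlitzPoly hP.ne_zero)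

theorem finiteDimensional_cyclotomicField (hP : P.Monic) :
    FiniteDimensional (RatFunc F) (cyclotomicField P) :=
  haveI := isSplittingField_cyclotomicField hP
  Polynomial.IsSplittingField.finiteDimensional _
    ((carlitzPoly F P).map (algebraMap F[X] (RatFunc F)))

theorem exists_ringOfIntegersVal_eq (hP : P.Monic) {x : KAlg F} (hx : x ∈ torsion P) :
    ∃ y : ringOfIntegers P, ringOfIntegersVal P y = x := by
  refine ⟨⟨⟨x, IntermediateField.subset_adjoin _ _ hx⟩, ?_⟩, rfl⟩
  refine ⟨carlitzPoly F P, (carlitzPoly_monic_natDegree hP).1, ?_⟩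
  rw [← Polynomial.aeval_def]
  have hinj : Function.Injective ((cyclotomicField P).val.restrictScalars F[X]) :=
    (cyclotomicField P).val.injective
  apply hinj
  rw [← Polynomial.aeval_algHom_apply, map_zero]
  exact (aeval_carlitzPoly_eq_carlitz P x).trans hx

theorem aeval_ringOfIntegersVal (a : F[X]) (x : ringOfIntegers P) :
    ringOfIntegersVal P (Polynomial.aeval x (carlitzPoly F a))
      = carlitz F a (ringOfIntegersVal P x) := by
  rw [← Polynomial.aeval_algHom_apply, aeval_carlitzPoly_eq_carlitz]

theorem aeval_carlitzPoly_eq_zero {x : ringOfIntegers P} (hx : ringOfIntegersVal P x ∈ torsion P) :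
    Polynomial.aeval x (carlitzPoly F P) = 0 := by
  apply ringOfIntegersVal_injective
  rw [aeval_ringOfIntegersVal, map_zero]
  exact hx

/-- The nonzero division points are associated. -/
theorem exists_associated_of_mem_torsion (hP_irr : Irreducible P)
    {lam : ringOfIntegers P} (hlam : IsPrimitiveTorsion P (ringOfIntegersVal P lam))
    {x : KAlg F} (hx : x ∈ torsion P) (hx0 : x ≠ 0) :
    ∃ y : ringOfIntegers P, ringOfIntegersVal P y = x ∧ Associated y lam := by
  obtain ⟨a, ha⟩ := hlam.2 x hx
  refine ⟨Polynomial.aeval lam (carlitzPoly F a), by rw [aeval_ringOfIntegersVal]; exact ha, ?_⟩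
  refine associated_aeval_carlitzPoly (hP_irr.coprime_iff_not_dvd.2 ?_)
    (aeval_carlitzPoly_eq_zero hlam.1)
  rintro ⟨b, rfl⟩
  apply hx0
  rw [← ha, mul_comm, map_mul, Module.End.mul_apply,
    show carlitz F P (ringOfIntegersVal P lam) = 0 from hlam.1, map_zero]

/-- `P` is associated to the product of the nonzero division points. -/
theorem associated_pow_of_isPrimitiveTorsion (hP : P.Monic) (hP_irr : Irreducible P)
    {lam : ringOfIntegers P} (hlam : IsPrimitiveTorsion P (ringOfIntegersVal P lam)) :
    Associated (lam ^ (Fintype.card F ^ P.natDegree - 1))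
      (algebraMap F[X] (ringOfIntegers P) P) := by
  set f := carlitzPolyDivX P with hf
  set s := (f.map (algebraMap F[X] (KAlg F))).roots with hs
  have hmonic := carlitzPolyDivX_monic hP
  have hsplit : (f.map (algebraMap F[X] (KAlg F))).Splits := IsAlgClosed.splits _
  have hcard : Multiset.card s = Fintype.card F ^ P.natDegree - 1 := by
    rw [hs, ← hsplit.natDegree_eq_card_roots, hmonic.natDegree_map, natDegree_carlitzPolyDivX hP]
  have hprod : (-1) ^ (Fintype.card F ^ P.natDegree - 1) * s.prod
      = algebraMap F[X] (KAlg F) P := by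
    have h1 := hsplit.coeff_zero_eq_prod_roots_of_monic (hmonic.map _)
    rw [Polynomial.coeff_map, coeff_zero_carlitzPolyDivX, hmonic.natDegree_map,
      natDegree_carlitzPolyDivX hP] at h1
    exact h1.symm
  have hroot : ∀ x ∈ s, ∃ y : ringOfIntegers P, ringOfIntegersVal P y = x ∧
      Associated y lam := fun x hx => by
    have hx1 : Polynomial.aeval x f = 0 := by
      rw [Polynomial.mem_roots (hmonic.map _).ne_zero, Polynomial.IsRoot,
        Polynomial.eval_map_algebraMap] at hx
      exact hx
    have hx0 : x ≠ 0 := by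
      rintro rfl
      rw [← Polynomial.coeff_zero_eq_aeval_zero', coeff_zero_carlitzPolyDivX] at hx1
      exact hP.ne_zero ((map_eq_zero_iff _ (algebraMap_KAlg_injective F)).1 hx1)
    refine exists_associated_of_mem_torsion hP_irr hlam ?_ hx0
    change carlitz F P x = 0
    rw [← aeval_carlitzPoly_eq_carlitz, aeval_carlitzPoly_eq_mul, hx1, mul_zero]
  have hlist : ∀ t : Multiset (KAlg F), (∀ x ∈ t, ∃ y : ringOfIntegers P,
      ringOfIntegersVal P y = x ∧ Associated y lam) → ∃ y : ringOfIntegers P,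
      ringOfIntegersVal P y = t.prod ∧ Associated y (lam ^ Multiset.card t) := by
    intro t
    induction t using Multiset.induction_on with
    | empty => intro _; exact ⟨1, by simp, by simp⟩
    | cons x t ih =>
      intro ht
      obtain ⟨y, hy1, hy2⟩ := ht x (Multiset.mem_cons_self x t)
      obtain ⟨z, hz1, hz2⟩ := ih fun w hw => ht w (Multiset.mem_cons_of_mem hw)
      refine ⟨y * z, by rw [map_mul, hy1, hz1, Multiset.prod_cons], ?_⟩
      rw [Multiset.card_cons, pow_succ']
      exact hy2.mul_mul hz2
  obtain ⟨y, hy1, hy2⟩ := hlist s hroot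
  have hPy : algebraMap F[X] (ringOfIntegers P) P
      = (-1) ^ (Fintype.card F ^ P.natDegree - 1) * y := by
    apply ringOfIntegersVal_injective
    rw [AlgHom.commutes, map_mul, hy1, ← hprod, map_pow, map_neg, map_one]
  rw [hPy, ← hcard]
  refine hy2.symm.trans (associated_unit_mul_right _ _ ?_)
  exact isUnit_one.neg.pow _

end CyclotomicField

section GaloisAction

variable {F : Type*} [Field F] [Fintype F] {P : F[X]}

/-- The Galois group of `K_P / k` acts on the ring of integers of `K_P`. -/
noncomputable instance : MulSemiringAction Gal(cyclotomicField P/RatFunc F) (ringOfIntegers P) :=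
  IsIntegralClosure.MulSemiringAction F[X] (RatFunc F) (cyclotomicField P) (ringOfIntegers P)

theorem coe_smul_ringOfIntegers (σ : Gal(cyclotomicField P/RatFunc F)) (x : ringOfIntegers P) :
    ((σ • x : ringOfIntegers P) : cyclotomicField P) = σ x :=
  algebraMap_galRestrict_apply F[X] σ x

theorem smul_eq_galRestrict (σ : Gal(cyclotomicField P/RatFunc F)) (x : ringOfIntegers P) :
    σ • x = galRestrict F[X] (RatFunc F) (cyclotomicField P) (ringOfIntegers P) σ x := rfl

instance : SMulCommClass Gal(cyclotomicField P/RatFunc F) F[X] (ringOfIntegers P) where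
  smul_comm σ a x := by
    rw [smul_eq_galRestrict, smul_eq_galRestrict, map_smul]

theorem isInvariant_ringOfIntegers (hP : P.Monic) :
    Algebra.IsInvariant F[X] (ringOfIntegers P) Gal(cyclotomicField P/RatFunc F) :=
  haveI := isGalois_cyclotomicField hP
  haveI := finiteDimensional_cyclotomicField hP
  haveI : IsFractionRing (ringOfIntegers P) (cyclotomicField P) :=
    IsIntegralClosure.isFractionRing_of_finite_extension F[X] (RatFunc F) _ _
  Algebra.isInvariant_of_isGalois F[X] (RatFunc F) (cyclotomicField P) (ringOfIntegers P)

instance : FaithfulSMul F[X] (ringOfIntegers P) := by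
  rw [faithfulSMul_iff_algebraMap_injective]
  intro a b hab
  apply algebraMap_KAlg_injective F
  rw [← AlgHom.commutes (ringOfIntegersVal P), hab, AlgHom.commutes]

theorem smul_aeval (σ : Gal(cyclotomicField P/RatFunc F)) (Q : F[X][X]) (x : ringOfIntegers P) :
    σ • Polynomial.aeval x Q = Polynomial.aeval (σ • x) Q :=
  (Polynomial.aeval_algHom_apply
    (galRestrict F[X] (RatFunc F) (cyclotomicField P) (ringOfIntegers P) σ) x Q).symm

theorem eq_of_smul_eq {lam : ringOfIntegers P}
    (hlam : IsPrimitiveTorsion P (ringOfIntegersVal P lam))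
    {σ τ : Gal(cyclotomicField P/RatFunc F)} (h : σ • lam = τ • lam) : σ = τ := by
  have hval : ∀ x ∈ torsion P, ∀ y : cyclotomicField P, (y : KAlg F) = x → σ y = τ y := by
    intro x hx y hy
    obtain ⟨a, rfl⟩ := hlam.2 x hx
    have hy' : y = ((Polynomial.aeval lam (carlitzPoly F a) : ringOfIntegers P) :
        cyclotomicField P) := by
      apply Subtype.ext
      rw [hy, ← aeval_ringOfIntegersVal]; rfl
    rw [hy', ← coe_smul_ringOfIntegers, ← coe_smul_ringOfIntegers, smul_aeval, smul_aeval, h]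
  have key : ∀ (x : KAlg F) (hx : x ∈ cyclotomicField P), σ ⟨x, hx⟩ = τ ⟨x, hx⟩ := by
    intro x hx
    induction hx using IntermediateField.adjoin_induction with
    | mem x hx => exact hval x hx _ rfl
    | algebraMap x => exact (σ.commutes x).trans (τ.commutes x).symm
    | add x y hx hy h1 h2 =>
      have := congrArg₂ (· + ·) h1 h2
      simp only [← map_add] at this
      exact this
    | inv x hx h1 =>
      have := congrArg (·⁻¹) h1
      simp only [← map_inv₀] at this
      exact this
    | mul x y hx hy h1 h2 =>
      have := congrArg₂ (· * ·) h1 h2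
      simp only [← map_mul] at this
      exact this
  exact AlgEquiv.ext fun x => key x x.2

theorem lam_ne_zero (hP : P.Monic) (hP_irr : Irreducible P) {lam : ringOfIntegers P}
    (hlam : IsPrimitiveTorsion P (ringOfIntegersVal P lam)) : lam ≠ 0 := by
  rintro rfl
  have h := associated_pow_of_isPrimitiveTorsion hP hP_irr hlam
  have hn : Fintype.card F ^ P.natDegree - 1 ≠ 0 :=
    (Nat.sub_pos_of_lt (Nat.one_lt_pow hP_irr.natDegree_pos.ne' Fintype.one_lt_card)).ne'
  rw [zero_pow hn] at h
  have := h.symm.eq_zero_iff.2 rfl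
  exact hP.ne_zero ((map_eq_zero_iff _ (FaithfulSMul.algebraMap_injective F[X] _)).1 this)

theorem isTotallyRamifiedGenerator (hP : P.Monic) (hP_irr : Irreducible P)
    [FiniteDimensional (RatFunc F) (cyclotomicField P)]
    {lam : ringOfIntegers P} (hlam : IsPrimitiveTorsion P (ringOfIntegersVal P lam)) :
    IsTotallyRamifiedGenerator F[X] (ringOfIntegers P) Gal(cyclotomicField P/RatFunc F) P
      (Fintype.card F ^ P.natDegree - 1) lam (carlitzPolyDivX P) := by
  have hlam0 := lam_ne_zero hP hP_irr hlam
  have hinv := isInvariant_ringOfIntegers hP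
  have hassoc := associated_pow_of_isPrimitiveTorsion hP hP_irr hlam
  have hn : Fintype.card F ^ P.natDegree - 1 ≠ 0 :=
    (Nat.sub_pos_of_lt (Nat.one_lt_pow hP_irr.natDegree_pos.ne' Fintype.one_lt_card)).ne'
  have hroot : Polynomial.aeval lam (carlitzPolyDivX P) = 0 := by
    have := aeval_carlitzPoly_eq_zero hlam.1
    rw [aeval_carlitzPoly_eq_mul] at this
    exact (mul_eq_zero.1 this).resolve_left hlam0
  have hmonic : ((carlitzPolyDivX P).map (algebraMap F[X] (ringOfIntegers P))).Monic :=
    (carlitzPolyDivX_monic hP).map _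
  refine ⟨hP_irr.prime, hn, ?_, coeff_zero_carlitzPolyDivX P, ?_, hassoc⟩
  · have hdvd : (∏ σ : Gal(cyclotomicField P/RatFunc F),
        (Polynomial.X - Polynomial.C (σ • lam)))
        ∣ (carlitzPolyDivX P).map (algebraMap F[X] (ringOfIntegers P)) := by
      have hinj : Function.Injective
          fun σ : Gal(cyclotomicField P/RatFunc F) => σ • lam := fun _ _ h => eq_of_smul_eq hlam h
      have hle : (Finset.univ.val.map fun σ : Gal(cyclotomicField P/RatFunc F) => σ • lam)
          ≤ ((carlitzPolyDivX P).map (algebraMap F[X] (ringOfIntegers P))).roots := by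
        rw [Multiset.le_iff_subset (Finset.univ.nodup.map hinj)]
        intro x hx
        obtain ⟨σ, -, rfl⟩ := Multiset.mem_map.1 hx
        rw [Polynomial.mem_roots hmonic.ne_zero, Polynomial.IsRoot,
          Polynomial.eval_map_algebraMap, ← smul_aeval, hroot, smul_zero]
      have := (Multiset.prod_X_sub_C_dvd_iff_le_roots hmonic.ne_zero _).2 hle
      rw [Multiset.map_map] at this
      exact this
    have hmonic' : (∏ σ : Gal(cyclotomicField P/RatFunc F),
        (Polynomial.X - Polynomial.C (σ • lam))).Monic :=
      Polynomial.monic_prod_of_monic _ _ fun σ _ => Polynomial.monic_X_sub_C _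
    refine (Polynomial.eq_of_monic_of_dvd_of_natDegree_le hmonic' hmonic hdvd ?_)
    rw [(carlitzPolyDivX_monic hP).natDegree_map, natDegree_carlitzPolyDivX hP,
      Polynomial.natDegree_prod_of_monic _ _ fun σ _ => Polynomial.monic_X_sub_C _]
    simp only [Polynomial.natDegree_X_sub_C, Finset.sum_const, smul_eq_mul, mul_one]
    obtain ⟨c, hc⟩ := Algebra.IsInvariant.isInvariant (A := F[X])
      (G := Gal(cyclotomicField P/RatFunc F))
      (∏ σ : Gal(cyclotomicField P/RatFunc F), σ • lam) fun τ => by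
        rw [Finset.smul_prod']
        exact Fintype.prod_equiv (Equiv.mulLeft τ) _ _ fun σ => by simp [mul_smul]
    refine Nat.le_of_dvd (Finset.card_pos.2 Finset.univ_nonempty)
      (hP_irr.prime.dvd_of_associated_pow (c := c) hn
        (Algebra.IsInvariant.associated_of_algebraMap (B := ringOfIntegers P)
          (G := Gal(cyclotomicField P/RatFunc F)) ?_))
    rw [map_pow, map_pow, hc, ← Finset.prod_pow, ← Finset.prod_const]
    refine Associated.prod _ _ _ fun σ _ => ?_
    have := hassoc.map (MulSemiringAction.toRingHom _ (ringOfIntegers P) σ)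
    simpa using this
  · have := congrArg (Polynomial.aeval lam) (derivative_carlitzPolyDivX P)
    rw [map_add, hroot, zero_add, map_mul, Polynomial.aeval_X, Polynomial.aeval_C] at this
    rw [← this, mul_comm]

/-- The conjugates of a primitive division point are its multiples prime to `P`. -/
theorem exists_smul_eq_aeval_carlitzPoly (hP : P.Monic) (hP_irr : Irreducible P)
    {lam : ringOfIntegers P} (hlam : IsPrimitiveTorsion P (ringOfIntegersVal P lam))
    {a : F[X]} (ha : ¬ P ∣ a) : ∃ σ : Gal(cyclotomicField P/RatFunc F),
      σ • lam = Polynomial.aeval lam (carlitzPoly F a) := by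
  have := finiteDimensional_cyclotomicField hP
  have h := isTotallyRamifiedGenerator hP hP_irr hlam
  have hlam0 := lam_ne_zero hP hP_irr hlam
  have htors := aeval_carlitzPoly_eq_zero hlam.1
  have hne : Polynomial.aeval lam (carlitzPoly F a) ≠ 0 := fun h0 =>
    hlam0 ((associated_aeval_carlitzPoly (hP_irr.coprime_iff_not_dvd.2 ha) htors).eq_zero_iff.1 h0)
  have hroot : Polynomial.aeval (Polynomial.aeval lam (carlitzPoly F a)) (carlitzPolyDivX P)
      = 0 := by
    have h1 : Polynomial.aeval (Polynomial.aeval lam (carlitzPoly F a)) (carlitzPoly F P) = 0 := by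
      rw [← aeval_carlitzPoly_mul, mul_comm, aeval_carlitzPoly_mul, htors, aeval_zero_carlitzPoly]
    rw [aeval_carlitzPoly_eq_mul] at h1
    exact (mul_eq_zero.1 h1).resolve_left hne
  rw [← Polynomial.eval_map_algebraMap, h.map_eq, Polynomial.eval_prod,
    Finset.prod_eq_zero_iff] at hroot
  obtain ⟨σ, -, hσ⟩ := hroot
  refine ⟨σ, ?_⟩
  simp only [Polynomial.eval_sub, Polynomial.eval_X, Polynomial.eval_C] at hσ
  exact (sub_eq_zero.1 hσ).symm

theorem aeval_carlitzPoly_congr {lam : ringOfIntegers P}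
    (hlam : ringOfIntegersVal P lam ∈ torsion P) {a b : F[X]} (h : P ∣ a - b) :
    Polynomial.aeval lam (carlitzPoly F a) = Polynomial.aeval lam (carlitzPoly F b) := by
  obtain ⟨c, hc⟩ := h
  rw [sub_eq_iff_eq_add.1 hc, aeval_carlitzPoly_add, mul_comm, aeval_carlitzPoly_mul,
    aeval_carlitzPoly_eq_zero hlam, aeval_zero_carlitzPoly, zero_add]

theorem IsPrimitiveRootMod.not_dvd (hP_irr : Irreducible P) {g : F[X]}
    (hg : IsPrimitiveRootMod P g) : ¬ P ∣ g := by
  obtain ⟨u, hu, -⟩ := hg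
  intro h
  rw [Ideal.Quotient.eq_zero_iff_dvd P g |>.2 h] at hu
  have := u.isUnit
  rw [hu, isUnit_zero_iff, ← map_one (Ideal.Quotient.mk (Ideal.span {P})), eq_comm,
    Ideal.Quotient.eq_zero_iff_dvd] at this
  exact hP_irr.not_isUnit (isUnit_of_dvd_one this)

theorem IsPrimitiveRootMod.exists_dvd_sub_pow (hP : P.Monic) (hP_irr : Irreducible P) {g : F[X]}
    (hg : IsPrimitiveRootMod P g) {a : F[X]} (ha : ¬ P ∣ a) : ∃ i : ℕ, P ∣ a - g ^ i := by
  obtain ⟨u, hu, hu'⟩ := hg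
  obtain ⟨c, d, hcd⟩ := hP_irr.coprime_iff_not_dvd.2 ha
  have ha1 : IsUnit (Ideal.Quotient.mk (Ideal.span {P}) a) := by
    refine IsUnit.of_mul_eq_one_right (Ideal.Quotient.mk (Ideal.span {P}) d) ?_
    rw [← map_mul, ← map_one (Ideal.Quotient.mk (Ideal.span {P})), ← hcd, map_add,
      Ideal.Quotient.eq_zero_iff_dvd P (c * P) |>.2 (dvd_mul_left _ _), zero_add]
  obtain ⟨v, hv⟩ := ha1
  have : Finite (F[X] ⧸ Ideal.span {P}) := by
    have : Module.Finite F (AdjoinRoot P) := hP.finite_adjoinRoot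
    exact Module.finite_of_finite F (M := AdjoinRoot P)
  have hvu : v ∈ Submonoid.powers u := by
    rw [mem_powers_iff_mem_zpowers, hu']; trivial
  obtain ⟨i, hi⟩ := hvu
  refine ⟨i, ?_⟩
  rw [← Ideal.Quotient.eq_zero_iff_dvd, map_sub, map_pow, ← hu, ← hv, ← hi,
    Units.val_pow_eq_pow_val,
    sub_self]

theorem mem_zpowers_of_smul_eq (hP : P.Monic) (hP_irr : Irreducible P)
    {lam : ringOfIntegers P} (hlam : IsPrimitiveTorsion P (ringOfIntegersVal P lam)) {g : F[X]}
    (hg : IsPrimitiveRootMod P g) {σ : Gal(cyclotomicField P/RatFunc F)}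
    (hσ : σ • lam = Polynomial.aeval lam (carlitzPoly F g))
    (τ : Gal(cyclotomicField P/RatFunc F)) : τ ∈ Subgroup.zpowers σ := by
  have hpow : ∀ i : ℕ, σ ^ i • lam = Polynomial.aeval lam (carlitzPoly F (g ^ i)) := by
    intro i
    induction i with
    | zero => simp [carlitzPoly]
    | succ i ih =>
      rw [pow_succ', mul_smul, ih, smul_aeval, hσ, pow_succ, aeval_carlitzPoly_mul]
  have hτ : ringOfIntegersVal P (τ • lam) ∈ torsion P := by
    change carlitz F P _ = 0
    rw [← aeval_ringOfIntegersVal, ← smul_aeval, aeval_carlitzPoly_eq_zero hlam.1, smul_zero,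
      map_zero]
  obtain ⟨a, ha⟩ := hlam.2 _ hτ
  rw [← aeval_ringOfIntegersVal] at ha
  have ha' := ringOfIntegersVal_injective ha
  have hPa : ¬ P ∣ a := by
    intro h
    rw [aeval_carlitzPoly_congr hlam.1 (b := 0) (by simpa using h)] at ha'
    have h0 : τ • lam = 0 := by rw [← ha']; simp [carlitzPoly]
    exact lam_ne_zero hP hP_irr hlam ((smul_eq_zero_iff_eq τ).1 h0)
  obtain ⟨i, hi⟩ := hg.exists_dvd_sub_pow hP hP_irr hPa
  rw [aeval_carlitzPoly_congr hlam.1 hi, ← hpow] at ha'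
  rw [← eq_of_smul_eq hlam ha']
  exact ⟨i, by simp⟩

end GaloisAction

section Units

variable {F : Type*} [Field F] [Fintype F] {P : F[X]}

theorem unitVal_eq (u : (ringOfIntegers P)ˣ) :
    unitVal u = ringOfIntegersVal P (u : ringOfIntegers P) := rfl

theorem unitVal_ne_zero (u : (ringOfIntegers P)ˣ) : unitVal u ≠ 0 := by
  rw [unitVal_eq, Ne, map_eq_zero_iff _ ringOfIntegersVal_injective]
  exact u.ne_zero

theorem norm_smul (σ : Gal(cyclotomicField P/RatFunc F)) (x : ringOfIntegers P) :
    Algebra.norm (RatFunc F) ((σ • x : ringOfIntegers P) : cyclotomicField P)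
      = Algebra.norm (RatFunc F) (x : cyclotomicField P) := by
  rw [coe_smul_ringOfIntegers]
  exact (Algebra.norm_eq_of_algEquiv σ (x : cyclotomicField P))

theorem mem_normOneUnits_of_mul_smul_eq [FiniteDimensional (RatFunc F) (cyclotomicField P)]
    {σ : Gal(cyclotomicField P/RatFunc F)}
    {u : (ringOfIntegers P)ˣ} {x : ringOfIntegers P} (hx : x ≠ 0)
    (h : (u : ringOfIntegers P) * σ • x = x) : u ∈ normOneUnits P := by
  rw [mem_normOneUnits]
  have h1 := congrArg (fun y : ringOfIntegers P =>
    Algebra.norm (RatFunc F) (y : cyclotomicField P)) h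
  simp only [MulMemClass.coe_mul, map_mul] at h1
  rw [norm_smul] at h1
  refine mul_right_cancel₀ (b := Algebra.norm (RatFunc F) (x : cyclotomicField P)) ?_
    (by rw [h1, one_mul])
  rw [Algebra.norm_ne_zero_iff]
  exact fun h0 => hx (Subtype.ext h0)

/-- The homomorphism `δ ↦ δ / σ(δ)` from units to units of norm one. -/
noncomputable def divSmulHom [FiniteDimensional (RatFunc F) (cyclotomicField P)]
    (σ : Gal(cyclotomicField P/RatFunc F)) :
    (ringOfIntegers P)ˣ →* normOneUnits P :=
  MonoidHom.codRestrict (MonoidHom.id _ / Units.map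
    (MulSemiringAction.toRingHom _ (ringOfIntegers P) σ : ringOfIntegers P →* ringOfIntegers P))
    (normOneUnits P) fun δ => mem_normOneUnits_of_mul_smul_eq (σ := σ) (x := δ) δ.ne_zero
      (congrArg Units.val (div_mul_cancel δ (Units.map
        (MulSemiringAction.toRingHom _ (ringOfIntegers P) σ :
          ringOfIntegers P →* ringOfIntegers P) δ)))

theorem eq_divSmulHom_iff [FiniteDimensional (RatFunc F) (cyclotomicField P)]
    {σ : Gal(cyclotomicField P/RatFunc F)} {u : normOneUnits P} {δ : (ringOfIntegers P)ˣ} :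
    u = divSmulHom σ δ ↔ ((u : (ringOfIntegers P)ˣ) : ringOfIntegers P) * σ • (δ : ringOfIntegers P)
      = δ := by
  have h1 : u = divSmulHom σ δ ↔ (u : (ringOfIntegers P)ˣ) = δ / Units.map
      (MulSemiringAction.toRingHom _ (ringOfIntegers P) σ :
        ringOfIntegers P →* ringOfIntegers P) δ := Subtype.ext_iff
  rw [h1, eq_div_iff_mul_eq', Units.ext_iff]
  rfl

theorem faithfulSMul_ringOfIntegers {lam : ringOfIntegers P}
    (hlam : IsPrimitiveTorsion P (ringOfIntegersVal P lam)) :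
    FaithfulSMul Gal(cyclotomicField P/RatFunc F) (ringOfIntegers P) :=
  ⟨fun h => eq_of_smul_eq hlam (h lam)⟩

theorem prod_smul_eq_one_of_mem_normOneUnits [FiniteDimensional (RatFunc F) (cyclotomicField P)]
    [IsGalois (RatFunc F) (cyclotomicField P)] {u : (ringOfIntegers P)ˣ}
    (hu : u ∈ normOneUnits P) :
    ∏ σ : Gal(cyclotomicField P/RatFunc F), σ • (u : ringOfIntegers P) = 1 := by
  rw [mem_normOneUnits] at hu
  apply Subtype.ext
  have h1 := Algebra.norm_eq_prod_automorphisms (RatFunc F)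
    ((u : ringOfIntegers P) : cyclotomicField P)
  rw [hu, map_one] at h1
  refine Eq.trans ?_ h1.symm
  refine (map_prod (ringOfIntegers P).val _ _).trans ?_
  exact Finset.prod_congr rfl fun σ _ => coe_smul_ringOfIntegers σ _

end Units

end CarlitzCyclotomic

set_option maxHeartbeats 4000000 in
open CarlitzCyclotomic in
/-- `G_℘` is a subgroup of index `q ^ deg ℘ - 1` of the group of norm-one units, and the quotient
is cyclic of that order, generated by the class of `λ / C_g(λ)`. -/
theorem mainTheorem3 (F : Type*) [Field F] [Fintype F] (P g : F[X])
    (hP_monic : P.Monic) (hP_irr : Irreducible P)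
    (hg : CarlitzCyclotomic.IsPrimitiveRootMod P g)
    (lam : CarlitzCyclotomic.KAlg F) (hlam : CarlitzCyclotomic.IsPrimitiveTorsion P lam) :
    ∃ G : Subgroup (CarlitzCyclotomic.normOneUnits P),
      (fun u : CarlitzCyclotomic.normOneUnits P =>
          CarlitzCyclotomic.unitVal (u : (CarlitzCyclotomic.ringOfIntegers P)ˣ)) '' (G : Set _)
        = CarlitzCyclotomic.quotientSet P g lam ∧
      G.index = Fintype.card F ^ P.natDegree - 1 ∧
      IsCyclic (CarlitzCyclotomic.normOneUnits P ⧸ G) ∧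
      Nat.card (CarlitzCyclotomic.normOneUnits P ⧸ G) = Fintype.card F ^ P.natDegree - 1 ∧
      ∃ r : CarlitzCyclotomic.normOneUnits P,
        CarlitzCyclotomic.unitVal (r : (CarlitzCyclotomic.ringOfIntegers P)ˣ)
          = lam / CarlitzCyclotomic.carlitz F g lam ∧
        Subgroup.zpowers (QuotientGroup.mk r : CarlitzCyclotomic.normOneUnits P ⧸ G) = ⊤ := by
  have := finiteDimensional_cyclotomicField hP_monic
  have := isGalois_cyclotomicField hP_monic
  have := isInvariant_ringOfIntegers hP_monic
  obtain ⟨lam, rfl⟩ := exists_ringOfIntegersVal_eq hP_monic hlam.1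
  have := faithfulSMul_ringOfIntegers hlam
  have h := isTotallyRamifiedGenerator hP_monic hP_irr hlam
  have hlam0 := h.lam_ne_zero
  obtain ⟨σ, hσ⟩ := exists_smul_eq_aeval_carlitzPoly hP_monic hP_irr hlam
    (hg.not_dvd hP_irr)
  have hgen := mem_zpowers_of_smul_eq hP_monic hP_irr hlam hg hσ
  obtain ⟨v, hv⟩ : Associated (σ • lam) lam := by
    rw [hσ]
    exact associated_aeval_carlitzPoly
      (hP_irr.coprime_iff_not_dvd.2 (hg.not_dvd hP_irr)) (aeval_carlitzPoly_eq_zero hlam.1)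
  have hσlam : ringOfIntegersVal P (σ • lam) = carlitz F g (ringOfIntegersVal P lam) := by
    rw [hσ, aeval_ringOfIntegersVal]
  have hv' : (v : ringOfIntegers P) * σ • lam = lam := by rw [mul_comm, hv]
  have hσlam0 : σ • lam ≠ 0 := fun h0 => hlam0 (by rw [← hv, h0, zero_mul])
  set r : normOneUnits P := ⟨v, mem_normOneUnits_of_mul_smul_eq hlam0 hv'⟩ with hr
  have hrpow : ∀ i : ℕ, (((r ^ i : normOneUnits P) : (ringOfIntegers P)ˣ) : ringOfIntegers P)
      * (σ • lam) ^ i = lam ^ i := fun i => by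
    rw [Subgroup.coe_pow, Units.val_pow_eq_pow_val, ← mul_pow, hv']
  have hmem : ∀ i : ℕ, ∀ δ : (ringOfIntegers P)ˣ, r ^ i = divSmulHom σ δ ↔
      lam ^ i * σ • (δ : ringOfIntegers P) = (σ • lam) ^ i * δ := fun i δ => by
    rw [eq_divSmulHom_iff, ← hrpow, ← mul_right_inj' (pow_ne_zero i hσlam0)]
    constructor <;> intro h1 <;> linear_combination h1
  set G : Subgroup (normOneUnits P) := (divSmulHom σ).range with hG
  have hzpow : Subgroup.zpowers (QuotientGroup.mk r : normOneUnits P ⧸ G) = ⊤ := by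
    rw [eq_top_iff]
    rintro x -
    obtain ⟨u, rfl⟩ := QuotientGroup.mk_surjective x
    obtain ⟨ε, hε0, hε⟩ := exists_ne_zero_mul_smul_eq hgen
      (prod_smul_eq_one_of_mem_normOneUnits u.2)
    obtain ⟨i, δ, hδ⟩ := h.exists_pow_mul_unit_eq hgen hε0 hε
    refine ⟨i, ?_⟩
    change (QuotientGroup.mk r : normOneUnits P ⧸ G) ^ (i : ℤ) = _
    rw [zpow_natCast, ← QuotientGroup.mk_pow, QuotientGroup.eq]
    refine ⟨δ, ?_⟩
    symm
    rw [eq_divSmulHom_iff]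
    refine mul_left_cancel₀ (((r ^ i : normOneUnits P) : (ringOfIntegers P)ˣ).ne_zero)
      (mul_left_cancel₀ (pow_ne_zero i hσlam0) ?_)
    have h1 : (((r ^ i : normOneUnits P) : (ringOfIntegers P)ˣ) : ringOfIntegers P)
        * ((((r ^ i)⁻¹ * u : normOneUnits P) : (ringOfIntegers P)ˣ) : ringOfIntegers P)
        = ((u : (ringOfIntegers P)ˣ) : ringOfIntegers P) := by
      have : r ^ i * ((r ^ i)⁻¹ * u) = u := mul_inv_cancel_left _ _
      exact congrArg (fun w : normOneUnits P => ((w : (ringOfIntegers P)ˣ) : ringOfIntegers P)) this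
    rw [← mul_assoc (((r ^ i : normOneUnits P) : (ringOfIntegers P)ˣ) : ringOfIntegers P), h1]
    linear_combination hδ - (δ : ringOfIntegers P) * hrpow i
  have horder : orderOf (QuotientGroup.mk r : normOneUnits P ⧸ G)
      = Fintype.card F ^ P.natDegree - 1 := by
    apply Nat.dvd_antisymm
    · obtain ⟨δ, hδ⟩ := h.exists_unit_pow_mul_smul_eq σ
      rw [orderOf_dvd_iff_pow_eq_one, ← QuotientGroup.mk_pow, QuotientGroup.eq_one_iff]
      exact ⟨δ, ((hmem _ δ).2 hδ).symm⟩
    · have h1 := pow_orderOf_eq_one (QuotientGroup.mk r : normOneUnits P ⧸ G)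
      rw [← QuotientGroup.mk_pow, QuotientGroup.eq_one_iff] at h1
      obtain ⟨δ, hδ⟩ := h1
      exact h.dvd_of_pow_mul_smul_eq hgen ((hmem _ δ).1 hδ.symm)
  have hcard : Nat.card (normOneUnits P ⧸ G) = Fintype.card F ^ P.natDegree - 1 := by
    rw [← horder, ← Nat.card_zpowers, hzpow, Subgroup.card_top]
  refine ⟨G, ?_, hcard, ⟨⟨QuotientGroup.mk r, fun x => hzpow.ge trivial⟩⟩, hcard, r, ?_, hzpow⟩
  · have hdiv : ∀ (u : normOneUnits P) (δ : (ringOfIntegers P)ˣ) (Q : F[X][X]),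
        (δ : ringOfIntegers P) = Polynomial.aeval lam Q → u = divSmulHom σ δ →
        unitVal (u : (ringOfIntegers P)ˣ) = Polynomial.aeval (ringOfIntegersVal P lam) Q
          / Polynomial.aeval (carlitz F g (ringOfIntegersVal P lam)) Q := by
      intro u δ Q hδ hu
      have h1 := congrArg (ringOfIntegersVal P) (eq_divSmulHom_iff.1 hu)
      rw [map_mul, hδ, smul_aeval, ← Polynomial.aeval_algHom_apply,
        ← Polynomial.aeval_algHom_apply, hσlam, ← unitVal_eq] at h1
      refine eq_div_of_mul_eq (fun h0 => ?_) h1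
      rw [h0, mul_zero, Polynomial.aeval_algHom_apply, ← hδ] at h1
      exact unitVal_ne_zero δ h1.symm
    ext y
    constructor
    · rintro ⟨u, ⟨δ, rfl⟩, rfl⟩
      obtain ⟨Q, hQ⟩ := h.exists_aeval (δ : ringOfIntegers P)
      refine ⟨Q, ⟨δ, ?_⟩, hdiv _ δ Q hQ rfl⟩
      rw [unitVal_eq, hQ, Polynomial.aeval_algHom_apply]
    · rintro ⟨Q, ⟨δ, hδ⟩, rfl⟩
      rw [unitVal_eq, Polynomial.aeval_algHom_apply] at hδ
      exact ⟨divSmulHom σ δ, ⟨δ, rfl⟩, hdiv _ δ Q (ringOfIntegersVal_injective hδ) rfl⟩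
  · rw [← hσlam, eq_div_iff (fun h0 => hσlam0 (ringOfIntegersVal_injective (by rw [h0, map_zero]))),
      unitVal_eq, ← map_mul, hv']
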